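/- Let $\mathbb{F}$ be a finite field. For nonzero $R \in \mathbb{F}[t]$ put $|R| = |\mathbb{F}|^{\deg R}$, and for a nonconstant monic $Q \in \mathbb{F}[t]$ let $\mathrm{lpf}(Q)$ be the minimum of $|R|$ over the monic irreducible factors $R$ of $Q$. Write $\mathbb{F}[t]_Q = \mathbb{F}[t]/Q\mathbb{F}[t]$. A polynomial $P(y) \in \mathbb{F}[t][y]$ is called intersective if for every $Q \in \mathbb{F}[t]\setminus\{0\}$ there is $n \in \mathbb{F}[t]$ with $P(n) \equiv 0 \pmod Q$. Its derivational degree is the least $d \ge 0$ such that $\partial_{u_1,\dots,u_{d+1}}P(y) = 0$ for all $u_1,\dots,u_{d+1},y \in \mathbb{F}((t^{-1}))$, where $\partial_u f(x) = f(x+u)-f(x)$ and $\partial_{u_1,\dots,u_j} = \partial_{u_j}\partial_{u_1,\dots,u_{j-1}}$. Corollary. Let $P(y) \in \mathbb{F}[t][y]$ be a nonzero intersective polynomial of derivational degree $k$. Then there is a constant $C = C(P) > 0$ such that the following holds for every nonconstant monic $Q \in \mathbb{F}[t]$. If $A \subseteq \mathbb{F}[t]_Q$ does not contain distinct $a, b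 \in A$ with $b - a = P(y)$ for some $y \in \mathbb{F}[t]_Q$, then $$|A| \le C\, |Q| \cdot \mathrm{lpf}(Q)^{-1/2^{k-1}}.$$ In particular, if $Q$ is irreducible (so that $\mathbb{F}[t]_Q$ is a field with $|Q|$ elements), then $$|A| \le C\, |Q|^{1 - 1/2^{k-1}}.$$ -/

import Mathlib

open Polynomial

noncomputable section

/-- `P(y) ∈ F[t][y]` is intersective: it has a root modulo every nonzero `Q ∈ F[t]`. -/
def IsIntersective {F : Type*} [Field F] (P : F[X][X]) : Prop :=
  ∀ Q : F[X], Q ≠ 0 → ∃ n : F[X], Q ∣ P.eval n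

/-- The iterated differencing operator `∂_{u₁, …, uₖ} = ∂_{uₖ} ⋯ ∂_{u₁}`,
where `∂_u f (x) = f (x + u) - f x`. -/
def iteratedDiff {R : Type*} [AddCommGroup R] (us : List R) (f : R → R) : R → R :=
  us.foldl (fun g u => fwdDiff u g) f

open Classical in
/-- The field `F((t⁻¹))`, the completion of `F(t)` at the place at infinity. -/
abbrev LaurentAtInfty (F : Type*) [Field F] : Type _ := RatFunc.CompletionAtInfty F

open Classical in
/-- The canonical embedding `F[t] → F(t) → F((t⁻¹))`. -/
def toLaurentAtInfty (F : Type*) [Field F] : F[X] →+* LaurentAtInfty F :=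
  (algebraMap (RatFunc F) (RatFunc.CompletionAtInfty F)).comp (algebraMap F[X] (RatFunc F))

/-- The set of `d` such that `∂_{u₁, …, u_{d+1}} P (y) = 0` for all `u₁, …, u_{d+1}, y`
in the field. -/
def vanishingOrders {K : Type*} [Field K] (P : K[X]) : Set ℕ :=
  {d | ∀ us : List K, us.length = d + 1 → ∀ y : K, iteratedDiff us (fun x => P.eval x) y = 0}

/-- The derivational degree of `P(y) ∈ F((t⁻¹))[y]`: the least `d ≥ 0` such that
`∂_{u₁, …, u_{d+1}} P (y) = 0` for all `u₁, …, u_{d+1}, y ∈ F((t⁻¹))`. -/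
def derivationalDegree {F : Type*} [Field F] (P : (LaurentAtInfty F)[X]) : ℕ :=
  sInf (vanishingOrders P)

/-- `lpf(Q)`, the size of the least prime factor: the minimum of `|R| = |F| ^ deg R` over the monic
irreducible factors `R` of `Q`. Meaningful for nonconstant `Q`, which have such a factor. -/
def lpf {F : Type*} [Field F] [Fintype F] (Q : F[X]) : ℤ :=
  sInf {n : ℤ | ∃ R : F[X], R.Monic ∧ Irreducible R ∧ R ∣ Q ∧ cardPowDegree R = n}

/-- `A ⊆ F[t]/(Q)` contains no distinct `a, b` with `b - a = P(y)` for some `y ∈ F[t]/(Q)`. -/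
def AvoidsDifferences {F : Type*} [Field F] (P : F[X][X]) (Q : F[X])
    (A : Finset (F[X] ⧸ Ideal.span {Q})) : Prop :=
  ¬ ∃ a ∈ A, ∃ b ∈ A, a ≠ b ∧ ∃ y : F[X] ⧸ Ideal.span {Q}, b - a = aeval y P

theorem vanishingOrders_nonempty {K : Type*} [Field K] (P : K[X]) :
    (vanishingOrders P).Nonempty := by
  have key : ∀ (us : List K) (P : K[X]), P.natDegree < us.length →
      ∀ y, iteratedDiff us (fun x => P.eval x) y = 0 := by
    intro us
    induction us with
    | nil => intro P h; simp at h
    | cons u us ih =>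
      intro P h y
      have e : iteratedDiff (u :: us) (fun x => P.eval x)
          = iteratedDiff us (fun x => (P.comp (X + C u) - P).eval x) := by
        unfold iteratedDiff
        rw [List.foldl_cons]
        congr 1
        funext x
        simp [fwdDiff]
      rw [e]
      have hc : (P.comp (X + C u)).natDegree = P.natDegree := by
        rw [natDegree_comp, natDegree_X_add_C, mul_one]
      have hl : (P.comp (X + C u)).leadingCoeff = P.leadingCoeff := by
        rw [leadingCoeff_comp (by simp)]; simp
      by_cases h0 : P.natDegree = 0
      · obtain ⟨c, rfl⟩ := natDegree_eq_zero.mp h0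
        have hz : ∀ vs : List K, iteratedDiff vs (fun _ => (0 : K)) = fun _ => 0 := by
          intro vs
          unfold iteratedDiff
          induction vs with
          | nil => rfl
          | cons v vs ihv => simpa [fwdDiff] using ihv
        have : iteratedDiff us (fun x => ((C c).comp (X + C u) - C c).eval x) = fun _ => 0 := by
          simpa using hz us
        rw [this]
      · apply ih
        have hP : P ≠ 0 := by rintro rfl; simp at h0
        have hP' : P.comp (X + C u) ≠ 0 := by
          intro hh; rw [hh] at hc; simp at hc; exact h0 hc.symm
        have hd : (P.comp (X + C u)).degree = P.degree := by
          rw [degree_eq_natDegree hP', degree_eq_natDegree hP, hc]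
        have hlt := degree_sub_lt_left hd hP' hl
        have hlt' : (P.comp (X + C u) - P).natDegree < P.natDegree := by
          by_cases hz : P.comp (X + C u) - P = 0
          · rw [hz]; simp; omega
          · rw [hd] at hlt
            exact natDegree_lt_natDegree hz hlt
        simp at h
        omega
  exact ⟨P.natDegree, fun us hus y => key us P (by omega) y⟩

end

/-!
The proof restricts to one residue field and does Fourier analysis there.

Let `R` be a monic irreducible factor of `Q` of least norm, `κ = F[t] / (R)` and
`G = F[t] / (Q)`. In characteristic `p`, a high power of the Frobenius lifts residues modulo `R`
to a ring homomorphism `φ : κ → G` (not preserving `1` unless `Q` is a power of `R`), see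
`exists_nonUnitalRingHom_quotient`. Let `y₀` be a root of `P` in `G`. Only the differences
`P (y₀ + φ z)` with `z ∈ κ` are used. Composed with an additive character `χ` of `G`, they become
`ψ (f z)`, where `ψ` is the trace character of `κ` and `f` is a polynomial over `κ` with
`f (0) = 0` and degree at most `deg P`.

Since `ψ (x ^ p) = ψ x`, the monomials `c X ^ (m p ^ a)` with a common `m` prime to `p` can be
merged into one (`reducedForm`). If nothing is left, then `χ (P (y₀ + φ z)) = 1` for all `z`.
Otherwise Weyl differencing bounds the sum of `ψ ∘ f` (`norm_sum_pow_le`); the point is that the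
reduced form of `f (X + u) - f (X)` vanishes for boundedly many `u` only
(`card_reducedForm_taylor_sub_eq_zero_le`). The number of differencing steps is governed by the
derivational degree `k` of `P`: vanishing of the `(k + 1)`-fold differences over the infinite
field `F((t⁻¹))` is a polynomial identity, so it holds in `G` too (`iteratedDiff_map_eq_zero`).

Finally, in the character expansion of the number of pairs `(a, z)` with `a` and
`a + P (y₀ + φ z)` in `A`, the characters of the first kind contribute a nonnegative amount
because `P (y₀) = 0`, and the others little (`card_le_of_addChar_sum`). As `P (y₀ + φ z)` has at
most `deg P` zeros, this bounds `A`. Intersectivity excludes `k = 0`, and small `R` are absorbed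
into the constant.
-/

/-! ### Vanishing differences of polynomials and base change -/

theorem iteratedDiff_cons {R : Type*} [AddCommGroup R] (u : R) (us : List R) (f : R → R) :
    iteratedDiff (u :: us) f = iteratedDiff us (fwdDiff u f) := rfl

theorem fwdDiff_eval {R : Type*} [CommRing R] (u : R) (P : R[X]) :
    fwdDiff u (fun x => P.eval x) = fun x => (taylor u P - P).eval x := by
  funext x
  simp [fwdDiff, taylor_eval]

theorem map_iteratedDiff_eval {S T : Type*} [CommRing S] [CommRing T] (ρ : S →+* T)
    (us : List S) (P : S[X]) (y : S) :
    ρ (iteratedDiff us (fun x => P.eval x) y)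
      = iteratedDiff (us.map ρ) (fun x => (P.map ρ).eval x) (ρ y) := by
  induction us generalizing P with
  | nil => simp [iteratedDiff, eval_map]
  | cons u us ih =>
    rw [iteratedDiff_cons, fwdDiff_eval, ih, List.map_cons, iteratedDiff_cons, fwdDiff_eval]
    simp

/-- Over an infinite domain `S`, vanishing of all `n`-fold differences of `P` is a polynomial
identity, so it persists after base change to any commutative `S`-algebra. The induction adjoins
one indeterminate increment at a time. -/
theorem iteratedDiff_map_eq_zero (n : ℕ) :
    ∀ {S : Type*} {T : Type*} [CommRing S] [IsDomain S] [Infinite S] [CommRing T] (ρ : S →+* T)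
      (P : S[X])
      (_ : ∀ us : List S, us.length = n → ∀ y, iteratedDiff us (fun x => P.eval x) y = 0)
      (us : List T), us.length = n → ∀ y, iteratedDiff us (fun x => (P.map ρ).eval x) y = 0 := by
  induction n with
  | zero =>
    intro S T _ _ _ _ ρ P hP us hus y
    have h0 : P = 0 := Polynomial.funext fun r => by simpa [iteratedDiff] using hP [] rfl r
    obtain rfl := List.length_eq_zero_iff.1 hus
    simp [iteratedDiff, h0]
  | succ n ih =>
    intro S T _ _ _ _ ρ P hP us hus y
    obtain ⟨u, us, rfl⟩ := List.exists_cons_of_length_eq_add_one hus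
    rw [iteratedDiff_cons, fwdDiff_eval]
    -- `P(y + U) - P(y)` as a polynomial in `y` over `S[U]`
    set P' : S[X][X] := taylor (X : S[X]) (P.map C) - P.map C with hP'
    have hvan : ∀ us : List S[X], us.length = n →
        ∀ y, iteratedDiff us (fun x => P'.eval x) y = 0 := by
      intro vs hvs y
      refine Polynomial.funext fun s => ?_
      have h1 := map_iteratedDiff_eval (evalRingHom s) vs P' y
      have h2 : P'.map (evalRingHom s) = taylor s P - P := by
        have : (evalRingHom s).comp C = RingHom.id S := by ext; simp
        simp [hP', Polynomial.map_map, this]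
      rw [h2, ← fwdDiff_eval s, ← iteratedDiff_cons s, hP _ (by simp [hvs])] at h1
      simpa using h1
    have h3 : P'.map (eval₂RingHom ρ u) = taylor u (P.map ρ) - P.map ρ := by
      have : (eval₂RingHom ρ u).comp C = ρ := by ext; simp
      simp [hP', Polynomial.map_map, this]
    rw [← h3]
    exact ih (eval₂RingHom ρ u) P' hvan us (by simpa using hus) y

/-! ### Phase polynomials -/

/-- `g : V → ℂ` is a phase polynomial of degree at most `d`: applying `d + 1` multiplicative
differences `g ↦ g (· + u) / g` gives `1`. The last of these differences is written without a
division; the notion is used for nowhere vanishing `g` only. -/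
def IsPhasePoly {V : Type*} [AddCommGroup V] : ℕ → (V → ℂ) → Prop
  | 0, g => ∀ u z, g (z + u) = g z
  | d + 1, g => ∀ u, IsPhasePoly d fun z => g (z + u) / g z

theorem IsPhasePoly.comp_affine {V W : Type*} [AddCommGroup V] [AddCommGroup W] (φ : W →+ V)
    (v : V) {d : ℕ} {g : V → ℂ} (h : IsPhasePoly d g) : IsPhasePoly d fun z => g (v + φ z) := by
  induction d generalizing g with
  | zero => intro u z; simpa [add_assoc] using h (φ u) (v + φ z)
  | succ d ih => intro u; simpa [add_assoc] using ih (h (φ u))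

theorem isPhasePoly_const_mul {V : Type*} [AddCommGroup V] {c : ℂ} (hc : c ≠ 0) {d : ℕ}
    {g : V → ℂ} : IsPhasePoly d (fun z => c * g z) ↔ IsPhasePoly d g := by
  cases d with
  | zero => simp [IsPhasePoly, hc]
  | succ d => simp only [IsPhasePoly, mul_div_mul_left _ _ hc]

theorem isPhasePoly_addChar {V : Type*} [AddCommGroup V] (χ : AddChar V ℂ) {d : ℕ} {g : V → V}
    (h : ∀ us : List V, us.length = d + 1 → ∀ y, iteratedDiff us g y = 0) :
    IsPhasePoly d fun z => χ (g z) := by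
  induction d generalizing g with
  | zero =>
    intro u z
    have := h [u] rfl z
    rw [show iteratedDiff [u] g z = g (z + u) - g z from rfl, sub_eq_zero] at this
    simp [this]
  | succ d ih =>
    intro u
    have := ih (g := fwdDiff u g) fun us hus y => h (u :: us) (by simp [hus]) y
    simpa [fwdDiff, AddChar.map_sub_eq_div] using this

/-! ### Reduced forms -/

theorem addChar_map_sum {V ι : Type*} [AddCommMonoid V] (χ : AddChar V ℂ) (s : Finset ι)
    (f : ι → V) : χ (∑ i ∈ s, f i) = ∏ i ∈ s, χ (f i) := by
  classical
  induction s using Finset.induction_on with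
  | empty => simp
  | insert i s hi ih => rw [Finset.sum_insert hi, Finset.prod_insert hi,
      AddChar.map_add_eq_mul, ih]

theorem addChar_pow_eq {κ : Type*} [CommRing κ] (p : ℕ) {ψ : AddChar κ ℂ}
    (hF : ∀ x, ψ (x ^ p) = ψ x) (a : ℕ) (x : κ) :
    ψ (x ^ p ^ a) = ψ x := by
  induction a with
  | zero => simp
  | succ a ih => rw [pow_succ, pow_mul, hF, ih]

section ReducedForm

variable {κ : Type*} [Field κ] (p : ℕ) [Fact p.Prime] [CharP κ p] [PerfectRing κ p]

/-- The reduced form of a polynomial `f` of degree at most `N` over a perfect field of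
characteristic `p`: its constant term is dropped, and each monomial `c X ^ (m p ^ a)` with
`p ∤ m` is replaced by `c ^ (1 / p ^ a) X ^ m`. A Frobenius-invariant additive character takes
the same values on both up to the constant term. Polynomials whose coefficients at multiples of
`p`, including `0`, vanish are called reduced below. -/
noncomputable def reducedForm (N : ℕ) (f : κ[X]) : κ[X] :=
  ∑ j ∈ Finset.Icc 1 N, monomial (ordCompl[p] j)
    ((iterateFrobeniusEquiv κ p (j.factorization p)).symm (f.coeff j))

theorem reducedForm_coeff (N : ℕ) (f : κ[X]) (m : ℕ) :
    (reducedForm p N f).coeff m = ∑ j ∈ (Finset.Icc 1 N).filter (fun j => ordCompl[p] j = m),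
      (iterateFrobeniusEquiv κ p (j.factorization p)).symm (f.coeff j) := by
  simp [reducedForm, coeff_monomial, Finset.sum_filter]

theorem reducedForm_coeff_of_dvd (N : ℕ) (f : κ[X]) {m : ℕ} (hm : p ∣ m) :
    (reducedForm p N f).coeff m = 0 := by
  rw [reducedForm_coeff, Finset.filter_eq_empty_iff.2, Finset.sum_empty]
  rintro j hj rfl
  have hj0 : j ≠ 0 := by have := (Finset.mem_Icc.1 hj).1; omega
  exact Nat.not_dvd_ordCompl Fact.out hj0 hm

theorem natDegree_reducedForm_le (N : ℕ) (f : κ[X]) : (reducedForm p N f).natDegree ≤ N := by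
  refine natDegree_sum_le_of_forall_le _ _ fun j hj => ?_
  exact (natDegree_monomial_le _).trans ((Nat.ordCompl_le j p).trans (Finset.mem_Icc.1 hj).2)

theorem addChar_eval_eq {ψ : AddChar κ ℂ} (hF : ∀ x, ψ (x ^ p) = ψ x) {N : ℕ} {f : κ[X]}
    (hf : f.natDegree ≤ N) (z : κ) :
    ψ (f.eval z) = ψ (f.coeff 0) * ψ ((reducedForm p N f).eval z) := by
  have h1 : f.eval z = f.coeff 0 + ∑ j ∈ Finset.Icc 1 N, f.coeff j * z ^ j := by
    rw [eval_eq_sum_range' (Nat.lt_succ_of_le hf), Finset.range_eq_Ico,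
      Finset.sum_eq_sum_Ico_succ_bot (Nat.succ_pos _)]
    simp only [pow_zero, mul_one]
    rfl
  rw [h1, AddChar.map_add_eq_mul, reducedForm, eval_finsetSum, addChar_map_sum,
    addChar_map_sum]
  congr 1
  refine Finset.prod_congr rfl fun j _ => ?_
  conv_rhs => rw [eval_monomial, ← addChar_pow_eq p hF (j.factorization p), mul_pow, ← pow_mul,
    ← iterateFrobeniusEquiv_def κ, RingEquiv.apply_symm_apply, mul_comm (j / _),
    Nat.ordProj_mul_ordCompl_eq_self]

/-- If `f` is a reduced polynomial of degree `n + 1 ≥ 2`, the reduced form of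
`f (X + u) - f (X)` vanishes for few `u` only. Write `n = m p ^ a` with `p ∤ m`; the `p ^ a`-th
power of the coefficient of `X ^ m` in that reduced form is a polynomial in `u` whose linear
coefficient is `(n + 1)` times the leading coefficient of `f`. -/
theorem card_reducedForm_taylor_sub_eq_zero_le [Fintype κ] {n : ℕ} (hn : n ≠ 0) {f : κ[X]}
    (hdeg : f.natDegree = n + 1) (hpn : ¬ p ∣ n + 1) :
    {u : κ | reducedForm p n (taylor u f - f) = 0}.ncard ≤ (n + 1) ^ 2 := by
  classical
  have hp : p.Prime := Fact.out
  set m := ordCompl[p] n with hm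
  set a := n.factorization p with ha
  have hna : p ^ a * m = n := Nat.ordProj_mul_ordCompl_eq_self n p
  have hpa : p ^ a ≤ n := Nat.ordProj_le p hn
  set J := (Finset.Icc 1 n).filter (fun j => ordCompl[p] j = m) with hJ
  have hJle : ∀ j ∈ J, j.factorization p ≤ a := by
    intro j hj
    obtain ⟨h1, h2⟩ := Finset.mem_filter.1 hj
    obtain ⟨h3, h4⟩ := Finset.mem_Icc.1 h1
    have h5 : p ^ j.factorization p * m = j := by
      rw [← h2]; exact Nat.ordProj_mul_ordCompl_eq_self j p
    have hm0 : 0 < m := Nat.ordCompl_pos p hn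
    refine (Nat.pow_le_pow_iff_right hp.one_lt).1 (Nat.le_of_mul_le_mul_right ?_ hm0)
    rw [h5, hna]; exact h4
  have hJlt : ∀ j ∈ J, j ≠ n → a - j.factorization p ≠ 0 := by
    intro j hj hjn h
    obtain ⟨h1, h2⟩ := Finset.mem_filter.1 hj
    have h5 : p ^ j.factorization p * m = j := by
      rw [← h2]; exact Nat.ordProj_mul_ordCompl_eq_self j p
    have h6 : j.factorization p = a := le_antisymm (hJle j hj) (by omega)
    exact hjn (by rw [← h5, h6, hna])
  have hnJ : n ∈ J := by simp [hJ, hm]; omega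
  set h : ℕ → κ[X] := fun j => hasseDeriv j f - C (f.coeff j) with hh
  set H : κ[X] := ∑ j ∈ J, h j ^ p ^ (a - j.factorization p) with hH
  have hHeval : ∀ u, H.eval u = (reducedForm p n (taylor u f - f)).coeff m ^ p ^ a := by
    intro u
    rw [reducedForm_coeff, ← hJ, ← iterateFrobenius_def, map_sum, hH, eval_finsetSum]
    refine Finset.sum_congr rfl fun j hj => ?_
    have h7 : a = (a - j.factorization p) + j.factorization p := by
      have := hJle j hj; omega
    rw [iterateFrobenius_def]
    conv_rhs => rw [h7, pow_add, mul_comm, pow_mul, ← iterateFrobeniusEquiv_def κ p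
      (j.factorization p), RingEquiv.apply_symm_apply]
    simp [hh, taylor_coeff]
  have hHcoeff : H.coeff 1 = (n + 1 : ℕ) * f.leadingCoeff := by
    rw [hH, finsetSum_coeff, Finset.sum_eq_single_of_mem n hnJ]
    · simp [hh, ← ha, hasseDeriv_coeff, leadingCoeff, hdeg, add_comm 1 n]
    -- the other summands are `p`-th powers, so they have no linear term
    · intro j hj hjn
      obtain ⟨b, hb⟩ := Nat.exists_eq_succ_of_ne_zero (hJlt j hj hjn)
      have h8 : derivative (h j ^ p ^ (a - j.factorization p)) = 0 := by
        rw [hb, derivative_pow]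
        simp
      have h9 := congrArg (fun q => coeff q 0) h8
      simpa [coeff_derivative] using h9
  have hH0 : H ≠ 0 := by
    intro h0
    rw [h0, coeff_zero] at hHcoeff
    have hf0 : f.leadingCoeff ≠ 0 := by
      rw [leadingCoeff_ne_zero]; rintro rfl; simp at hdeg
    exact (mul_ne_zero (mt (CharP.cast_eq_zero_iff κ p (n + 1)).1 hpn) hf0) hHcoeff.symm
  have hHdeg : H.natDegree ≤ (n + 1) ^ 2 := by
    refine natDegree_sum_le_of_forall_le _ _ fun j hj => ?_
    refine natDegree_pow_le.trans ?_
    rw [sq]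
    refine Nat.mul_le_mul ?_ ?_
    · exact ((Nat.pow_le_pow_right hp.pos (Nat.sub_le _ _)).trans hpa).trans (Nat.le_succ n)
    · rw [hh, natDegree_sub_C]
      exact (natDegree_hasseDeriv_le _ _).trans (by omega)
  have hsub : {u : κ | reducedForm p n (taylor u f - f) = 0} ⊆ (H.roots.toFinset : Set κ) := by
    intro u hu
    have hu' : reducedForm p n (taylor u f - f) = 0 := hu
    simp only [Finset.mem_coe, Multiset.mem_toFinset, mem_roots hH0, IsRoot.def, hHeval, hu',
      coeff_zero]
    exact zero_pow (pow_ne_zero _ hp.ne_zero)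
  calc _ ≤ (H.roots.toFinset : Set κ).ncard := Set.ncard_le_ncard hsub (Finset.finite_toSet _)
    _ = H.roots.toFinset.card := Set.ncard_coe_finset _
    _ ≤ _ := (Multiset.toFinset_card_le _).trans ((card_roots' H).trans hHdeg)

end ReducedForm

/-! ### Weyl sums over finite fields -/

theorem addChar_apply_ne_zero {V : Type*} [AddCommGroup V] (χ : AddChar V ℂ) (v : V) :
    χ v ≠ 0 := (χ.val_isUnit v).ne_zero

/-- A reduced polynomial of degree at most `1` is linear. -/
theorem eval_eq_of_natDegree_le_one {κ : Type*} [Field κ] (p : ℕ) {f : κ[X]}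
    (hred : ∀ j, p ∣ j → f.coeff j = 0)
    (hf : f.natDegree ≤ 1) (z : κ) : f.eval z = f.coeff 1 * z := by
  rw [eval_eq_sum_range' (Nat.lt_succ_of_le hf), Finset.sum_range_succ, Finset.sum_range_one,
    hred 0 (dvd_zero p)]
  simp

theorem coeff_one_ne_zero_of_natDegree_le_one {κ : Type*} [Field κ] (p : ℕ) {f : κ[X]}
    (hred : ∀ j, p ∣ j → f.coeff j = 0)
    (hf : f.natDegree ≤ 1) (h0 : f ≠ 0) : f.coeff 1 ≠ 0 := by
  intro h1
  apply h0
  ext j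
  rcases j with _ | _ | j
  · exact hred 0 (dvd_zero p)
  · exact h1
  · exact coeff_eq_zero_of_natDegree_lt (by omega)

theorem not_dvd_natDegree_of_reduced {κ : Type*} [Field κ] (p : ℕ) {f : κ[X]}
    (hred : ∀ j, p ∣ j → f.coeff j = 0)
    (h0 : f ≠ 0) : ¬ p ∣ f.natDegree := fun h =>
  h0 (leadingCoeff_eq_zero.1 (hred _ h))

theorem natDegree_taylor_sub_le {κ : Type*} [Field κ] (f : κ[X]) (u : κ) {n : ℕ}
    (hf : f.natDegree = n + 1) : (taylor u f - f).natDegree ≤ n := by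
  have hf0 : f ≠ 0 := by rintro rfl; simp at hf
  by_cases h : taylor u f - f = 0
  · simp [h]
  have h1 : (taylor u f - f).degree < (taylor u f).degree :=
    degree_sub_lt_left (degree_taylor _ _) (by simpa using hf0) (by rw [leadingCoeff_taylor])
  have h2 := natDegree_lt_natDegree h h1
  rw [natDegree_taylor] at h2
  omega

/-- The van der Corput (Weyl differencing) inequality over a finite field. -/
theorem norm_sum_sq_le {κ : Type*} [Field κ] [Fintype κ] (ψ : AddChar κ ℂ) (f : κ[X]) :
    ‖∑ z, ψ (f.eval z)‖ ^ 2 ≤ ∑ u, ‖∑ z, ψ ((taylor u f - f).eval z)‖ := by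
  have h1 : (∑ z, ψ (f.eval z)) * starRingEnd ℂ (∑ z, ψ (f.eval z))
      = ∑ u, ∑ z, ψ ((taylor u f - f).eval z) := by
    rw [map_sum, Finset.mul_sum, Finset.sum_comm]
    refine Finset.sum_congr rfl fun z _ => ?_
    rw [Finset.sum_mul, ← Equiv.sum_comp (Equiv.addLeft z)]
    refine Finset.sum_congr rfl fun u _ => ?_
    rw [eval_sub, taylor_eval, sub_eq_add_neg, AddChar.map_add_eq_mul, AddChar.map_neg_eq_conj]
    rfl
  calc ‖∑ z, ψ (f.eval z)‖ ^ 2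
      = ‖(∑ z, ψ (f.eval z)) * starRingEnd ℂ (∑ z, ψ (f.eval z))‖ := by
        rw [norm_mul, RCLike.norm_conj, sq]
    _ ≤ _ := by rw [h1]; exact norm_sum_le _ _

section WeylSum

variable {κ : Type*} [Field κ] [Fintype κ] (p : ℕ) [Fact p.Prime] [CharP κ p] [PerfectRing κ p]
  {ψ : AddChar κ ℂ}

theorem ncard_bad_le {f : κ[X]} {n N : ℕ} (hf : f.natDegree = n + 1) (hn : n ≠ 0)
    (hred : ∀ j, p ∣ j → f.coeff j = 0) (hN : n + 1 ≤ N) :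
    {u : κ | reducedForm p n (taylor u f - f) = 0}.ncard ≤ N ^ 2 := by
  have h0 : f ≠ 0 := by rintro rfl; simp at hf
  refine (card_reducedForm_taylor_sub_eq_zero_le p hn hf ?_).trans (Nat.pow_le_pow_left hN 2)
  rw [← hf]
  exact not_dvd_natDegree_of_reduced p hred h0

/-- Over a field that is large compared with its degree, a nonzero reduced polynomial is not
annihilated by `ψ`: differencing lowers the degree and keeps the reduced form nonzero. -/
theorem exists_addChar_eval_ne_one (hψ : ψ.IsPrimitive) (hF : ∀ x, ψ (x ^ p) = ψ x) {N : ℕ}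
    (hq : N ^ 2 < Fintype.card κ) : ∀ (n : ℕ) (_ : n ≤ N) (f : κ[X]) (_ : f.natDegree ≤ n)
      (_ : ∀ j, p ∣ j → f.coeff j = 0) (_ : f ≠ 0), ∃ z, ψ (f.eval z) ≠ 1 := by
  intro n
  induction n with
  | zero =>
    intro _ f hf hred h0
    refine absurd ?_ h0
    rw [eq_C_of_natDegree_le_zero hf, hred 0 (dvd_zero p), C_0]
  | succ n ih =>
    intro hn f hf hred h0
    by_cases hlt : f.natDegree ≤ n
    · exact ih (by omega) f hlt hred h0
    have hdeg : f.natDegree = n + 1 := by omega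
    by_cases hn0 : n = 0
    · subst hn0
      obtain ⟨z, hz⟩ := AddChar.ne_one_iff.1
        (hψ (coeff_one_ne_zero_of_natDegree_le_one p hred hf h0))
      exact ⟨z, by rwa [eval_eq_of_natDegree_le_one p hred hf]⟩
    · obtain ⟨u, hu⟩ : ∃ u, reducedForm p n (taylor u f - f) ≠ 0 := by
        by_contra! hall
        have h1 := ncard_bad_le p hdeg hn0 hred hn
        simp only [hall, Set.ofPred_true, Set.ncard_univ, Nat.card_eq_fintype_card] at h1
        omega
      obtain ⟨z, hz⟩ := ih (by omega) _ (natDegree_reducedForm_le p n _)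
        (fun j hj => reducedForm_coeff_of_dvd p n _ hj) hu
      by_contra! hall
      have h2 : ∀ z, ψ ((taylor u f - f).eval z) = 1 := by
        intro z
        rw [eval_sub, taylor_eval, AddChar.map_sub_eq_div, hall, hall, div_one]
      have h3 := h2 0
      rw [← coeff_zero_eq_eval_zero] at h3
      have h4 := addChar_eval_eq p hF (natDegree_taylor_sub_le f u hdeg) z
      rw [h2, h3, one_mul] at h4
      exact hz h4.symm

/-- Weyl's inequality: if `ψ ∘ f` is a phase polynomial of degree at most `d + 1` and `f` is
reduced, nonzero, of degree at most `N`, then the sum of `ψ ∘ f` saves a factor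
`q ^ (1 / 2 ^ d)` over the trivial bound. -/
theorem norm_sum_pow_le (hψ : ψ.IsPrimitive) (hF : ∀ x, ψ (x ^ p) = ψ x) {N : ℕ}
    (hq : N ^ 2 < Fintype.card κ) (d : ℕ) : ∀ (f : κ[X]) (_ : f.natDegree ≤ N)
      (_ : ∀ j, p ∣ j → f.coeff j = 0) (_ : f ≠ 0)
      (_ : IsPhasePoly (d + 1) fun z => ψ (f.eval z)),
      ‖∑ z, ψ (f.eval z)‖ ^ 2 ^ d ≤ d * N ^ 2 * (Fintype.card κ : ℝ) ^ (2 ^ d - 1) := by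
  classical
  induction d with
  | zero =>
    intro f hf hred h0 hphase
    obtain ⟨w, hw⟩ := exists_addChar_eval_ne_one p hψ hF hq N le_rfl f hf hred h0
    have hzero : ψ (f.eval 0) = 1 := by
      rw [← coeff_zero_eq_eval_zero, hred 0 (dvd_zero p), AddChar.map_zero_eq_one]
    have hmul : ∀ z, ψ (f.eval (z + w)) = ψ (f.eval w) * ψ (f.eval z) := by
      intro z
      have h1 := hphase w z 0
      simp only [zero_add, hzero, div_one] at h1
      rw [← h1, div_mul_cancel₀ _ (addChar_apply_ne_zero _ _)]
    have h2 : ∑ z, ψ (f.eval z) = ψ (f.eval w) * ∑ z, ψ (f.eval z) := by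
      rw [Finset.mul_sum, ← Equiv.sum_comp (Equiv.addRight w) fun z => ψ (f.eval z)]
      exact Finset.sum_congr rfl fun z _ => hmul z
    have h3 : ∑ z, ψ (f.eval z) = 0 := by
      have : (1 - ψ (f.eval w)) * ∑ z, ψ (f.eval z) = 0 := by linear_combination h2
      exact (mul_eq_zero.1 this).resolve_left (sub_ne_zero.2 hw.symm)
    simp [h3]
  | succ d ih =>
    intro f hf hred h0 hphase
    set q : ℝ := (Fintype.card κ : ℝ) with hqdef
    have hq0 : 0 < q := by simp [hqdef, Fintype.card_pos]
    have hpow : 2 ^ d ≠ 0 := by positivity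
    by_cases hdeg : f.natDegree ≤ 1
    · have h3 : ∑ z, ψ (f.eval z) = 0 := by
        have := AddChar.sum_eq_zero_of_ne_one
          (hψ (coeff_one_ne_zero_of_natDegree_le_one p hred hdeg h0))
        simpa [eval_eq_of_natDegree_le_one p hred hdeg] using this
      rw [h3, norm_zero, zero_pow (by positivity)]
      positivity
    obtain ⟨n, hn⟩ : ∃ n, f.natDegree = n + 1 := ⟨f.natDegree - 1, by omega⟩
    have hn0 : n ≠ 0 := by omega
    set S : κ → ℝ := fun u => ‖∑ z, ψ ((taylor u f - f).eval z)‖ with hS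
    set bad : Finset κ := Finset.univ.filter fun u => reducedForm p n (taylor u f - f) = 0
      with hbad
    have hbadcard : (bad.card : ℝ) ≤ N ^ 2 := by
      have := ncard_bad_le p hn hn0 hred (hn ▸ hf)
      rw [Set.ncard_eq_toFinset_card'] at this
      have h2 : bad.card ≤ N ^ 2 := by simpa [hbad] using this
      exact_mod_cast h2
    have hS0 : ∀ u ∈ Finset.univ, 0 ≤ S u := fun u _ => norm_nonneg _
    have hStriv : ∀ u, S u ≤ q := by
      intro u
      refine (norm_sum_le _ _).trans ?_
      simp [hqdef]
    have hSgood : ∀ u, u ∉ bad → S u ^ 2 ^ d ≤ d * N ^ 2 * q ^ (2 ^ d - 1) := by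
      intro u hu
      have hu' : reducedForm p n (taylor u f - f) ≠ 0 := by simpa [hbad] using hu
      have hval := addChar_eval_eq p hF (natDegree_taylor_sub_le f u hn)
      have h1 : IsPhasePoly (d + 1)
          fun z => ψ ((reducedForm p n (taylor u f - f)).eval z) := by
        have h2 := hphase u
        rw [← isPhasePoly_const_mul (addChar_apply_ne_zero ψ ((taylor u f - f).coeff 0))]
        simpa only [← hval, eval_sub, taylor_eval, AddChar.map_sub_eq_div] using h2
      have h2 := ih _ ((natDegree_reducedForm_le p n _).trans (by omega))
        (fun j hj => reducedForm_coeff_of_dvd p n _ hj) hu' h1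
      have h3 : S u = ‖∑ z, ψ ((reducedForm p n (taylor u f - f)).eval z)‖ := by
        simp only [hS, hval]
        rw [← Finset.mul_sum, norm_mul, AddChar.norm_apply, one_mul]
      rwa [h3]
    have hsum : ∑ u, S u ^ 2 ^ d ≤ ((d + 1 : ℕ) * N ^ 2) * q ^ 2 ^ d := by
      have hsplit := Finset.sum_filter_add_sum_filter_not Finset.univ
        (fun u => reducedForm p n (taylor u f - f) = 0) (fun u => S u ^ 2 ^ d)
      have h1 : ∑ u ∈ bad, S u ^ 2 ^ d ≤ N ^ 2 * q ^ 2 ^ d := by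
        refine (Finset.sum_le_card_nsmul bad _ (q ^ 2 ^ d) fun u _ =>
          pow_le_pow_left₀ (norm_nonneg _) (hStriv u) _).trans ?_
        rw [nsmul_eq_mul]
        gcongr
      have h2 : ∑ u ∈ Finset.univ.filter (fun u => ¬ reducedForm p n (taylor u f - f) = 0),
          S u ^ 2 ^ d ≤ d * N ^ 2 * q ^ 2 ^ d := by
        refine (Finset.sum_le_card_nsmul _ _ (d * N ^ 2 * q ^ (2 ^ d - 1)) fun u hu =>
          hSgood u (by simpa [hbad] using hu)).trans ?_
        rw [nsmul_eq_mul]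
        have h3 : q ^ 2 ^ d = q * q ^ (2 ^ d - 1) := by
          rw [← pow_succ', Nat.sub_add_cancel (Nat.one_le_two_pow)]
        rw [h3, mul_left_comm]
        gcongr
        exact Nat.cast_le.2 (Finset.card_le_univ _)
      rw [← hsplit]
      calc _ ≤ N ^ 2 * q ^ 2 ^ d + d * N ^ 2 * q ^ 2 ^ d := add_le_add h1 h2
        _ = _ := by push_cast; ring
    calc ‖∑ z, ψ (f.eval z)‖ ^ 2 ^ (d + 1)
        = (‖∑ z, ψ (f.eval z)‖ ^ 2) ^ 2 ^ d := by rw [← pow_mul, pow_succ' 2 d]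
      _ ≤ (∑ u, S u) ^ 2 ^ d := by gcongr; exact norm_sum_sq_le ψ f
      _ ≤ q ^ (2 ^ d - 1) * ∑ u, S u ^ 2 ^ d := by
        have h4 := pow_sum_div_card_le_sum_pow (s := Finset.univ) hS0 (2 ^ d - 1)
        rw [Nat.sub_add_cancel Nat.one_le_two_pow, Finset.card_univ, div_le_iff₀ (by positivity)]
          at h4
        rwa [mul_comm]
      _ ≤ q ^ (2 ^ d - 1) * (((d + 1 : ℕ) * N ^ 2) * q ^ 2 ^ d) := by gcongr
      _ = _ := by
        have h5 : 2 ^ (d + 1) - 1 = (2 ^ d - 1) + 2 ^ d := by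
          have := Nat.one_le_two_pow (n := d); rw [pow_succ]; omega
        rw [h5, pow_add]; ring

end WeylSum

/-! ### Difference-avoiding sets -/

/-- Suppose that for each character `χ` of `G` the function `χ ∘ g` is either identically `1` or
has small sum, and that `g` has few zeros. Then a set without nonzero differences in the image
of `g` is small: expand the number of `(a, z)` with `a, a + g z ∈ A` into characters; those of
the first kind contribute a nonnegative amount. -/
theorem card_le_of_addChar_sum {G κ : Type*} [AddCommGroup G] [Fintype G] [Fintype κ]
    [Nonempty κ] (g : κ → G) {ε : ℝ} (hε : 0 ≤ ε)
    (hg : ∀ χ : AddChar G ℂ, (∀ z, χ (g z) = 1) ∨ ‖∑ z, χ (g z)‖ ≤ ε * Fintype.card κ)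
    {D : ℕ} (hD : {z | g z = 0}.ncard ≤ D) (A : Finset G)
    (hA : ∀ a ∈ A, ∀ z, a + g z ∈ A → g z = 0) :
    (A.card : ℝ) ≤ Fintype.card G * (ε + D / Fintype.card κ) := by
  classical
  set q : ℝ := (Fintype.card κ : ℝ) with hq
  have hq0 : 0 < q := by simp [hq, Fintype.card_pos]
  set M : ℝ := (Fintype.card G : ℝ) with hM
  have hM0 : 0 < M := by simp [hM, Fintype.card_pos]
  set α : ℝ := (A.card : ℝ) with hα
  set c : AddChar G ℂ → ℂ := fun χ => ∑ a ∈ A, χ a with hc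
  -- the number of pairs, as a character sum
  set n : ℕ := ∑ z, ((A ×ˢ A).filter fun x => x.1 + g z = x.2).card with hn
  have hcount : (∑ χ : AddChar G ℂ, (‖c χ‖ ^ 2 : ℝ) * ∑ z, χ (g z)) = M * n := by
    have h1 : ∀ χ : AddChar G ℂ, ((‖c χ‖ ^ 2 : ℝ) : ℂ) * ∑ z, χ (g z)
        = ∑ z, ∑ x ∈ A ×ˢ A, χ (x.1 + g z - x.2) := by
      intro χ
      have h2 : ((‖c χ‖ ^ 2 : ℝ) : ℂ) = ∑ x ∈ A ×ˢ A, χ x.1 * χ (- x.2) := by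
        rw [Finset.sum_product]
        simp only [← Finset.sum_mul_sum]
        simp only [AddChar.map_neg_eq_conj, ← map_sum]
        rw [Complex.mul_conj, Complex.normSq_eq_norm_sq]
      rw [h2, Finset.mul_sum]
      refine Finset.sum_congr rfl fun z _ => ?_
      rw [Finset.sum_mul]
      refine Finset.sum_congr rfl fun x _ => ?_
      rw [sub_eq_add_neg, AddChar.map_add_eq_mul, AddChar.map_add_eq_mul]
      ring
    push_cast at h1 ⊢
    simp_rw [h1]
    rw [Finset.sum_comm, hn]
    push_cast
    rw [Finset.mul_sum]
    refine Finset.sum_congr rfl fun z _ => ?_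
    rw [Finset.sum_comm]
    simp_rw [AddChar.sum_apply_eq_ite, sub_eq_zero]
    rw [← Finset.sum_filter, Finset.sum_const, nsmul_eq_mul, mul_comm]
    simp [hM]
  have hparseval : ∑ χ : AddChar G ℂ, ‖c χ‖ ^ 2 = M * α := by
    have h1 : ((∑ χ : AddChar G ℂ, ‖c χ‖ ^ 2 : ℝ) : ℂ) = M * α := by
      have h2 : ∀ χ : AddChar G ℂ, ((‖c χ‖ ^ 2 : ℝ) : ℂ) = ∑ a ∈ A, ∑ b ∈ A, χ (a - b) := by
        intro χ
        simp only [sub_eq_add_neg, AddChar.map_add_eq_mul, ← Finset.sum_mul_sum]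
        simp only [AddChar.map_neg_eq_conj, ← map_sum]
        rw [Complex.mul_conj, Complex.normSq_eq_norm_sq]
      rw [Complex.ofReal_sum]
      simp_rw [h2]
      rw [Finset.sum_comm]
      simp_rw [Finset.sum_comm (s := Finset.univ), AddChar.sum_apply_eq_ite, sub_eq_zero]
      simp [hM, hα, mul_comm]
    exact_mod_cast h1
  have hnle : (n : ℝ) ≤ α * D := by
    have h1 : n ≤ ∑ z, if g z = 0 then A.card else 0 := by
      refine Finset.sum_le_sum fun z _ => ?_
      split_ifs with hz
      · simp only [hz, add_zero]
        refine Finset.card_le_card_of_injOn Prod.fst (fun x hx => ?_) ?_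
        · simp only [Finset.coe_filter, Finset.mem_product, Set.mem_ofPred_eq] at hx
          exact hx.1.1
        · rintro ⟨x1, x2⟩ hx ⟨y1, y2⟩ hy hxy
          simp only [Finset.coe_filter, Finset.mem_product, Set.mem_ofPred_eq] at hx hy hxy
          rw [Prod.mk.injEq]
          exact ⟨hxy, by rw [← hx.2, ← hy.2, hxy]⟩
      · rw [Nat.le_zero, Finset.card_eq_zero, Finset.filter_eq_empty_iff]
        rintro ⟨a, b⟩ hab h
        obtain ⟨ha, hb⟩ := Finset.mem_product.1 hab
        exact hz (hA a ha z (by rw [show a + g z = b from h]; exact hb))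
    have h2 : (∑ z, if g z = 0 then A.card else 0) ≤ A.card * D := by
      rw [← Finset.sum_filter, Finset.sum_const, smul_eq_mul, mul_comm]
      refine Nat.mul_le_mul_left _ ?_
      rw [Set.ncard_eq_toFinset_card'] at hD
      simpa using hD
    rw [hα]
    exact_mod_cast h1.trans h2
  -- the trivial character contributes `α ^ 2 q`, every other one at least `- ε q ‖c χ‖ ^ 2`
  have hlow : α ^ 2 * q - ε * q * (M * α) ≤ M * n := by
    have h1 : (∑ χ : AddChar G ℂ, (‖c χ‖ ^ 2 * (∑ z, χ (g z)).re)) = M * n := by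
      have := congrArg Complex.re hcount
      simpa only [Complex.re_sum, Complex.re_ofReal_mul, ← Complex.ofReal_natCast,
        ← Complex.ofReal_mul, Complex.ofReal_re] using this
    rw [← h1, ← hparseval, Finset.mul_sum, sub_le_iff_le_add, ← Finset.sum_add_distrib]
    have hterm : ∀ χ : AddChar G ℂ,
        0 ≤ ‖c χ‖ ^ 2 * (∑ z, χ (g z)).re + ε * q * ‖c χ‖ ^ 2 := by
      intro χ
      have : 0 ≤ (∑ z, χ (g z)).re + ε * q := by
        rcases hg χ with h | h
        · simp only [h, Finset.sum_const, Finset.card_univ, nsmul_eq_mul, mul_one,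
            Complex.natCast_re]
          positivity
        · have := (abs_le.1 ((Complex.abs_re_le_norm _).trans h)).1
          linarith
      nlinarith [mul_nonneg (sq_nonneg ‖c χ‖) this]
    refine le_trans ?_ (Finset.single_le_sum (fun χ _ => hterm χ) (Finset.mem_univ 0))
    have h0 : ‖c 0‖ = α := by simp [hc, hα]
    have h2 : (∑ z : κ, (0 : AddChar G ℂ) (g z)).re = q := by simp [hq]
    rw [h0, h2]
    have : 0 ≤ ε * q * α ^ 2 := by positivity
    linarith
  rcases eq_or_lt_of_le (show 0 ≤ α by positivity) with hα0 | hα0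
  · rw [← hα0]; positivity
  have h3 : α * q ≤ M * (ε * q + D) := by
    have : M * n ≤ M * (α * D) := by gcongr
    refine le_of_mul_le_mul_left ?_ hα0
    nlinarith
  calc α ≤ M * (ε * q + D) / q := (le_div_iff₀ hq0).2 h3
    _ = _ := by field_simp

/-! ### Restriction to an embedded residue field -/

/-- The trace character: a primitive additive character of a finite field of characteristic `p`
that is invariant under the Frobenius. -/
theorem exists_frobenius_invariant_addChar (κ : Type*) [Field κ] [Finite κ] (p : ℕ)
    [Fact p.Prime] [CharP κ p] :
    ∃ ψ : AddChar κ ℂ, ψ.IsPrimitive ∧ ∀ x, ψ (x ^ p) = ψ x := by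
  let : Algebra (ZMod p) κ := ZMod.algebra κ p
  have : NeZero p := ⟨(Fact.out : p.Prime).ne_zero⟩
  set ψ : AddChar κ ℂ :=
    (ZMod.stdAddChar (N := p)).compAddMonoidHom (Algebra.trace (ZMod p) κ).toAddMonoidHom with hψ
  have happ : ∀ x, ψ x = ZMod.stdAddChar (Algebra.trace (ZMod p) κ x) := fun _ => rfl
  refine ⟨ψ, AddChar.IsPrimitive.of_ne_one ?_, fun x => ?_⟩
  · obtain ⟨x, hx⟩ := Algebra.trace_surjective (ZMod p) κ 1
    refine AddChar.ne_one_iff.2 ⟨x, ?_⟩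
    rw [happ, hx, ← AddChar.map_zero_eq_one (ZMod.stdAddChar (N := p))]
    exact fun h => one_ne_zero (ZMod.injective_stdAddChar h)
  · have h := Algebra.trace_eq_of_algEquiv
      (FiniteField.frobeniusAlgEquivOfAlgebraic (ZMod p) κ) x
    rw [FiniteField.frobeniusAlgEquivOfAlgebraic_apply, ZMod.card] at h
    rw [happ, happ, h]

/-- Every additive character of a finite field is a dilate of a given primitive one. -/
theorem exists_addChar_eq_mulShift {κ : Type*} [Field κ] [Finite κ] {ψ : AddChar κ ℂ}
    (hψ : ψ.IsPrimitive) (c : AddChar κ ℂ) : ∃ a, ∀ z, c z = ψ (a * z) := by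
  classical
  let := Fintype.ofFinite κ
  have hbij := (Fintype.bijective_iff_injective_and_card ψ.mulShift).2
    ⟨AddChar.to_mulShift_inj_of_isPrimitive hψ, AddChar.card_eq.symm⟩
  obtain ⟨a, rfl⟩ := hbij.2 c
  exact ⟨a, fun z => rfl⟩

/-- Let a finite field `κ` be embedded in a finite commutative ring `G` by a homomorphism `φ`
that need not preserve `1`. For a polynomial `P` with a root `y₀` in `G` and vanishing
`(d + 2)`-fold differences, composing `z ↦ P (y₀ + φ z)` with a character of `G` gives `ψ ∘ f`
for a polynomial `f` over `κ` of degree at most `deg P`, and Weyl's inequality applies unless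
the reduced form of `f` is zero, in which case `ψ ∘ f = 1`. -/
theorem card_le_of_nonUnitalRingHom {G κ : Type*} [CommRing G] [Fintype G] [Field κ] [Fintype κ]
    (p : ℕ) [Fact p.Prime] [CharP κ p] (φ : κ →ₙ+* G) (P : G[X]) {y₀ : G}
    (hy₀ : P.eval y₀ = 0) {d D : ℕ}
    (hP : ∀ us : List G, us.length = d + 2 → ∀ y, iteratedDiff us (fun x => P.eval x) y = 0)
    (hdeg : P.natDegree ≤ D) (hq : D ^ 2 < Fintype.card κ)
    (hroots : {z | P.eval (y₀ + φ z) = 0}.ncard ≤ D) (A : Finset G)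
    (hA : ∀ a ∈ A, ∀ z, a + P.eval (y₀ + φ z) ∈ A → P.eval (y₀ + φ z) = 0) :
    (A.card : ℝ) ≤ Fintype.card G *
      ((d * D ^ 2 / Fintype.card κ : ℝ) ^ (1 / 2 ^ d : ℝ) + D / Fintype.card κ) := by
  classical
  have := PerfectRing.ofFiniteOfIsReduced p κ
  obtain ⟨ψ, hψ, hF⟩ := exists_frobenius_invariant_addChar κ p
  have hq0 : (0 : ℝ) < Fintype.card κ := by simp [Fintype.card_pos]
  have hx0 : (0 : ℝ) ≤ d * D ^ 2 / Fintype.card κ := by positivity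
  refine card_le_of_addChar_sum (fun z => P.eval (y₀ + φ z)) (Real.rpow_nonneg hx0 _) ?_ hroots
    A hA
  intro χ
  have hφpow : ∀ (j : ℕ) (z : κ), φ z ^ (j + 1) = φ (z ^ (j + 1)) := by
    intro j z
    induction j with
    | zero => simp
    | succ j ih => rw [pow_succ, ih, ← map_mul, ← pow_succ]
  -- the coefficients of `f`
  have hcoeff : ∀ j, ∃ l : κ, ∀ z, χ ((taylor y₀ P).coeff j * φ z) = ψ (l * z) := fun j =>
    exists_addChar_eq_mulShift hψ (χ.compAddMonoidHom
      ((AddMonoidHom.mulLeft ((taylor y₀ P).coeff j)).comp (φ : κ →+ G)))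
  choose l hl using hcoeff
  set f : κ[X] := ∑ j ∈ Finset.range D, monomial (j + 1) (l (j + 1)) with hf
  have hfdeg : f.natDegree ≤ D := natDegree_sum_le_of_forall_le _ _ fun j hj =>
    (natDegree_monomial_le _).trans (Finset.mem_range.1 hj)
  have hfeval : ∀ z, χ (P.eval (y₀ + φ z)) = ψ (f.eval z) := by
    intro z
    rw [add_comm, ← taylor_eval,
      eval_eq_sum_range' (Nat.lt_succ_of_le ((natDegree_taylor P y₀).trans_le hdeg)),
      Finset.sum_range_succ', taylor_coeff_zero, hy₀, zero_mul, add_zero, hf, eval_finsetSum,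
      addChar_map_sum, addChar_map_sum]
    refine Finset.prod_congr rfl fun j _ => ?_
    rw [hφpow, hl, eval_monomial]
  have hf0 : f.coeff 0 = 0 := by simp [hf, coeff_monomial]
  have hred : ∀ z, ψ (f.eval z) = ψ ((reducedForm p D f).eval z) := by
    intro z
    rw [addChar_eval_eq p hF hfdeg, hf0, AddChar.map_zero_eq_one, one_mul]
  by_cases hz : reducedForm p D f = 0
  · left
    intro z
    rw [hfeval, hred, hz, eval_zero, AddChar.map_zero_eq_one]
  · right
    have hphase : IsPhasePoly (d + 1) fun z => ψ ((reducedForm p D f).eval z) := by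
      have h1 : IsPhasePoly (d + 1) fun z => χ (P.eval (y₀ + φ z)) :=
        (isPhasePoly_addChar χ hP).comp_affine (φ : κ →+ G) y₀
      simpa only [← hred, ← hfeval] using h1
    have hweyl := norm_sum_pow_le p hψ hF hq d _ (natDegree_reducedForm_le p D f)
      (fun j hj => reducedForm_coeff_of_dvd p D f hj) hz hphase
    simp only [hfeval, hred]
    have h2d : 2 ^ d ≠ 0 := by positivity
    refine (pow_le_pow_iff_left₀ (norm_nonneg _) (by positivity) h2d).1 (hweyl.trans_eq ?_)
    rw [mul_pow, ← Real.rpow_natCast (_ ^ _), ← Real.rpow_mul hx0]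
    have h1 : (1 / 2 ^ d : ℝ) * ((2 ^ d : ℕ) : ℝ) = 1 := by push_cast; field_simp
    have h3 : (Fintype.card κ : ℝ) ^ 2 ^ d
        = Fintype.card κ * (Fintype.card κ : ℝ) ^ (2 ^ d - 1) := by
      rw [← pow_succ', Nat.sub_add_cancel Nat.one_le_two_pow]
    rw [h1, Real.rpow_one, h3]
    field_simp

/-! ### Residue rings of `F[t]` -/

/-- The residue field at a prime factor `R` of `Q` embeds into `F[t] / (Q)`: if `R ∤ S`,
`Q = R ^ m S` and `E ≡ 1` modulo `R`, `E ≡ 0` modulo `S`, then `a ↦ (E a) ^ (p ^ m)` is additive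
and depends on `a` modulo `R` only. Reduced modulo `R`, it is a power of the Frobenius. -/
theorem exists_nonUnitalRingHom_quotient {F : Type*} [Field F] (p : ℕ) [Fact p.Prime] [CharP F p]
    {Q R : F[X]} (hQ : Q ≠ 0) (hR : Irreducible R) (hRQ : Ideal.span {Q} ≤ Ideal.span {R}) :
    ∃ (m : ℕ) (φ : (F[X] ⧸ Ideal.span {R}) →ₙ+* (F[X] ⧸ Ideal.span {Q})),
      ∀ z, Ideal.Quotient.factor hRQ (φ z) = z ^ p ^ m := by
  have hp : p.Prime := Fact.out
  obtain ⟨S, hS, hRS⟩ :=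
    (FiniteMultiplicity.of_prime_left hR.prime hQ).exists_eq_pow_mul_and_not_dvd
  set m := multiplicity R Q
  obtain ⟨a, b, hab⟩ := (hR.coprime_iff_not_dvd).2 hRS
  set E := b * S with hE
  have hER : R ∣ 1 - E := ⟨a, by rw [← hab]; ring⟩
  have hm : m ≤ p ^ m := (Nat.lt_pow_self hp.one_lt).le
  have hdvd : ∀ x : F[X], R ∣ x → Q ∣ (E * x) ^ p ^ m := by
    intro x hx
    rw [hS, mul_pow, mul_comm (R ^ m)]
    refine mul_dvd_mul ?_ ?_
    · exact (Dvd.intro_left b hE.symm).trans (dvd_pow_self _ (pow_ne_zero _ hp.ne_zero))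
    · exact (pow_dvd_pow_of_dvd hx m).trans (pow_dvd_pow x hm)
  have hkey : ∀ x y : F[X], R ∣ x - y →
      Ideal.Quotient.mk (Ideal.span {Q}) ((E * x) ^ p ^ m)
        = Ideal.Quotient.mk (Ideal.span {Q}) ((E * y) ^ p ^ m) := by
    intro x y hxy
    rw [Ideal.Quotient.mk_eq_mk_iff_sub_mem, Ideal.mem_span_singleton, ← sub_pow_char_pow,
      ← mul_sub]
    exact hdvd _ hxy
  have hsurj := Ideal.Quotient.mk_surjective (I := Ideal.span {R})
  choose r hr using hsurj
  have hrep : ∀ x y : F[X], Ideal.Quotient.mk (Ideal.span {R}) x = Ideal.Quotient.mk _ y →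
      R ∣ x - y := by
    intro x y h
    rwa [Ideal.Quotient.mk_eq_mk_iff_sub_mem, Ideal.mem_span_singleton] at h
  set g : F[X] ⧸ Ideal.span {R} → F[X] ⧸ Ideal.span {Q} :=
    fun z => Ideal.Quotient.mk _ ((E * r z) ^ p ^ m) with hg
  have hmul : ∀ z w, g (z * w) = g z * g w := by
    intro z w
    simp only [hg]
    rw [hkey (r (z * w)) (E * (r z * r w)), ← map_mul, ← mul_pow]
    · congr 2; ring
    · have h1 : R ∣ r (z * w) - r z * r w := hrep _ _ (by rw [map_mul, hr, hr, hr])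
      have h2 : r (z * w) - E * (r z * r w)
          = (r (z * w) - r z * r w) + (1 - E) * (r z * r w) := by ring
      rw [h2]
      exact dvd_add h1 (hER.mul_right _)
  have hzero : g 0 = 0 := by
    simp only [hg]
    rw [hkey (r 0) 0 (hrep _ _ (by rw [hr, map_zero])), mul_zero,
      zero_pow (pow_ne_zero _ hp.ne_zero), map_zero]
  have hadd : ∀ z w, g (z + w) = g z + g w := by
    intro z w
    simp only [hg]
    rw [hkey (r (z + w)) (r z + r w) (hrep _ _ (by rw [map_add, hr, hr, hr])), mul_add,
      add_pow_char_pow, map_add]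
  refine ⟨m, ⟨⟨g, hmul⟩, hzero, hadd⟩, fun z => ?_⟩
  change Ideal.Quotient.factor hRQ (Ideal.Quotient.mk _ ((E * r z) ^ p ^ m)) = _
  have h1 : Ideal.Quotient.mk (Ideal.span {R}) E = 1 := by
    rw [← map_one (Ideal.Quotient.mk (Ideal.span {R})), eq_comm,
      Ideal.Quotient.mk_eq_mk_iff_sub_mem, Ideal.mem_span_singleton]
    exact hER
  rw [Ideal.Quotient.factor_mk, map_pow, map_mul, h1, one_mul, hr]

theorem natCard_quotient_span {F : Type*} [Field F] [Fintype F] {Q : F[X]} (hQ : Q.Monic) :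
    (Nat.card (F[X] ⧸ Ideal.span {Q}) : ℤ) = cardPowDegree Q := by
  have := hQ.finite_quotient
  rw [cardPowDegree_nonzero Q hQ.ne_zero, Module.natCard_eq_pow_finrank (K := F),
    finrank_quotient_span_eq_natDegree, Nat.card_eq_fintype_card]
  push_cast
  rfl

theorem exists_lpf_eq {F : Type*} [Field F] [Fintype F] {Q : F[X]} (hQ : ¬ IsUnit Q) :
    ∃ R : F[X], R.Monic ∧ Irreducible R ∧ R ∣ Q ∧ cardPowDegree R = lpf Q := by
  obtain ⟨R, hR⟩ := exists_monic_irreducible_factor Q hQ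
  refine Int.csInf_mem (s := {n : ℤ | ∃ R : F[X], R.Monic ∧ Irreducible R ∧ R ∣ Q ∧
    cardPowDegree R = n}) ⟨_, R, hR.1, hR.2.1, hR.2.2, rfl⟩ ⟨0, ?_⟩
  rintro _ ⟨R, _, _, _, rfl⟩
  exact AbsoluteValue.nonneg _ _

theorem lpf_eq_of_irreducible {F : Type*} [Field F] [Fintype F] {Q : F[X]} (hQ : Q.Monic)
    (hirr : Irreducible Q) : lpf Q = cardPowDegree Q := by
  obtain ⟨R, hR, hRirr, hRQ, h⟩ := exists_lpf_eq hirr.not_isUnit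
  rw [← h, eq_of_monic_of_associated hR hQ (hRirr.associated_of_dvd hirr hRQ)]

theorem toLaurentAtInfty_injective (F : Type*) [Field F] :
    Function.Injective (toLaurentAtInfty F) := by
  classical
  exact (algebraMap (RatFunc F) (RatFunc.CompletionAtInfty F)).injective.comp
    (IsFractionRing.injective F[X] (RatFunc F))

/-- The differences of order exceeding the derivational degree of `P` vanish over every
commutative `F[t]`-algebra. -/
theorem iteratedDiff_eq_zero_of_derivationalDegree {F : Type*} [Field F] {P : F[X][X]} {k : ℕ}
    (hk : derivationalDegree (P.map (toLaurentAtInfty F)) = k) {T : Type*} [CommRing T]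
    (ρ : F[X] →+* T) (us : List T) (hus : us.length = k + 1) (y : T) :
    iteratedDiff us (fun x => (P.map ρ).eval x) y = 0 := by
  have hmem : k ∈ vanishingOrders (P.map (toLaurentAtInfty F)) :=
    hk ▸ Nat.sInf_mem (vanishingOrders_nonempty _)
  refine iteratedDiff_map_eq_zero (k + 1) ρ P (fun vs hvs x => ?_) us hus y
  apply toLaurentAtInfty_injective F
  rw [map_iteratedDiff_eval, map_zero]
  exact hmem _ (by simp [hvs]) _

/-- A polynomial of derivational degree `0` is constant, and a nonzero constant is not divisible
by every modulus. -/
theorem derivationalDegree_ne_zero {F : Type*} [Field F] {P : F[X][X]} (hP : IsIntersective P)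
    (hP0 : P ≠ 0) : derivationalDegree (P.map (toLaurentAtInfty F)) ≠ 0 := by
  intro hk
  have hconst : ∀ u, P.eval u = P.eval 0 := by
    intro u
    have := iteratedDiff_eq_zero_of_derivationalDegree hk (RingHom.id F[X]) [u] rfl 0
    simpa [iteratedDiff, fwdDiff, sub_eq_zero] using this
  have hPC : P = C (P.eval 0) := Polynomial.funext fun u => by rw [hconst, eval_C]
  have hc : P.eval 0 ≠ 0 := fun h => hP0 (by rw [hPC, h, C_0])
  obtain ⟨n, hn⟩ := hP (P.eval 0 * X) (mul_ne_zero hc X_ne_zero)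
  rw [hconst n] at hn
  have h1 := natDegree_le_of_dvd hn hc
  rw [natDegree_mul_X hc] at h1
  omega

/-! ### The bound for difference-avoiding sets modulo `Q` -/

/-- The estimate for a modulus with a large prime factor `R`. -/
theorem card_le_of_avoidsDifferences {F : Type*} [Field F] [Fintype F] {P : F[X][X]}
    (hP : IsIntersective P) {d : ℕ}
    (hk : derivationalDegree (P.map (toLaurentAtInfty F)) = d + 1) {Q R : F[X]} (hQ : Q.Monic)
    (hR : R.Monic) (hirr : Irreducible R) (hRQ : R ∣ Q) (hlead : ¬ R ∣ P.leadingCoeff)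
    (hlarge : (P.natDegree : ℤ) ^ 2 < cardPowDegree R) (A : Finset (F[X] ⧸ Ideal.span {Q}))
    (hA : AvoidsDifferences P Q A) :
    (A.card : ℝ) ≤ cardPowDegree Q *
      ((d * P.natDegree ^ 2 / cardPowDegree R : ℝ) ^ (1 / 2 ^ d : ℝ)
        + P.natDegree / cardPowDegree R) := by
  classical
  obtain ⟨p, hchar⟩ := CharP.exists F
  have hp : p.Prime := CharP.char_is_prime F p
  have : Fact p.Prime := ⟨hp⟩
  have := hQ.finite_quotient
  have := hR.finite_quotient
  have : Finite (F[X] ⧸ Ideal.span {Q}) := Module.finite_of_finite F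
  have : Finite (F[X] ⧸ Ideal.span {R}) := Module.finite_of_finite F
  let := Fintype.ofFinite (F[X] ⧸ Ideal.span {Q})
  let := Fintype.ofFinite (F[X] ⧸ Ideal.span {R})
  have := PrincipalIdealRing.isMaximal_of_irreducible hirr
  let : Field (F[X] ⧸ Ideal.span {R}) := Ideal.Quotient.field _
  have : CharP (F[X] ⧸ Ideal.span {R}) p :=
    charP_of_injective_algebraMap (algebraMap F (F[X] ⧸ Ideal.span {R})).injective p
  have hle : Ideal.span {Q} ≤ Ideal.span {R} := Ideal.span_singleton_le_span_singleton.2 hRQ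
  obtain ⟨m, φ, hφ⟩ := exists_nonUnitalRingHom_quotient p hQ.ne_zero hirr hle
  have hcardQ : (Fintype.card (F[X] ⧸ Ideal.span {Q}) : ℝ) = cardPowDegree Q := by
    rw [← natCard_quotient_span hQ, Nat.card_eq_fintype_card]; norm_cast
  have hcardR : (Fintype.card (F[X] ⧸ Ideal.span {R}) : ℝ) = cardPowDegree R := by
    rw [← natCard_quotient_span hR, Nat.card_eq_fintype_card]; norm_cast
  obtain ⟨n, hn⟩ := hP Q hQ.ne_zero
  set ρ := Ideal.Quotient.mk (Ideal.span {Q}) with hρ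
  have hy₀ : (P.map ρ).eval (ρ n) = 0 := by
    rw [eval_map_apply, Ideal.Quotient.eq_zero_iff_dvd]
    exact hn
  -- modulo `R` the polynomial does not vanish identically, and has few zeros
  set ρR := Ideal.Quotient.mk (Ideal.span {R}) with hρR
  have hPR : P.map ρR ≠ 0 := by
    intro h
    have h1 : ρR P.leadingCoeff = 0 := by
      have := congrArg (fun q => coeff q P.natDegree) h
      simpa using this
    rw [Ideal.Quotient.eq_zero_iff_dvd] at h1
    exact hlead h1
  have hcomp : (Ideal.Quotient.factor hle).comp ρ = ρR := by ext <;> rfl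
  have hinj : Function.Injective fun z : F[X] ⧸ Ideal.span {R} => ρR n + z ^ p ^ m :=
    fun z w h => iterateFrobenius_inj (F[X] ⧸ Ideal.span {R}) p m (add_left_cancel h)
  have hroots : {z | (P.map ρ).eval (ρ n + φ z) = 0}.ncard ≤ P.natDegree := by
    calc _ ≤ ((P.map ρR).roots.toFinset : Set (F[X] ⧸ Ideal.span {R})).ncard := by
          refine Set.ncard_le_ncard_of_injOn (fun z => ρR n + z ^ p ^ m) ?_ hinj.injOn
            (Finset.finite_toSet _)
          intro z hz
          have h1 := congrArg (Ideal.Quotient.factor hle)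
            (show (P.map ρ).eval (ρ n + φ z) = 0 from hz)
          rw [← eval_map_apply, Polynomial.map_map, hcomp, map_add, hφ, map_zero,
            ← RingHom.comp_apply, hcomp] at h1
          simp only [Finset.mem_coe, Multiset.mem_toFinset, mem_roots hPR, IsRoot.def]
          exact h1
      _ = _ := Set.ncard_coe_finset _
      _ ≤ _ := (Multiset.toFinset_card_le _).trans
          ((card_roots' _).trans natDegree_map_le)
  rw [← hcardQ, ← hcardR]
  refine card_le_of_nonUnitalRingHom p φ (P.map ρ) hy₀
    (fun us hus y => iteratedDiff_eq_zero_of_derivationalDegree hk ρ us hus y)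
    natDegree_map_le ?_ hroots A ?_
  · rw [← natCard_quotient_span hR, Nat.card_eq_fintype_card] at hlarge
    exact_mod_cast hlarge
  · intro a ha z haz
    by_contra hne
    refine hA ⟨a, ha, _, haz, fun h => hne (by simpa using h.symm), ρ n + φ z, ?_⟩
    rw [add_sub_cancel_left, eval_map, aeval_def]
    rfl

theorem mainTheorem2 {F : Type*} [Field F] [Fintype F]
    (P : F[X][X]) (hP : IsIntersective P) (hP0 : P ≠ 0)
    (k : ℕ) (hk : derivationalDegree (P.map (toLaurentAtInfty F)) = k) :
    ∃ C : ℝ, 0 < C ∧ ∀ Q : F[X], Q.Monic → Q ≠ 1 →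
      (∀ A : Finset (F[X] ⧸ Ideal.span {Q}), AvoidsDifferences P Q A →
        (A.card : ℝ) ≤
          C * ((cardPowDegree Q : ℝ) * (lpf Q : ℝ) ^ (-(1 / (2 : ℝ) ^ ((k : ℤ) - 1))))) ∧
      (Irreducible Q →
        IsField (F[X] ⧸ Ideal.span {Q}) ∧
        (Nat.card (F[X] ⧸ Ideal.span {Q}) : ℤ) = cardPowDegree Q ∧
        ∀ A : Finset (F[X] ⧸ Ideal.span {Q}), AvoidsDifferences P Q A →
          (A.card : ℝ) ≤ C * (cardPowDegree Q : ℝ) ^ (1 - 1 / (2 : ℝ) ^ ((k : ℤ) - 1))) := by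
  obtain ⟨d, rfl⟩ := Nat.exists_eq_succ_of_ne_zero (hk ▸ derivationalDegree_ne_zero hP hP0)
  have hexp : (2 : ℝ) ^ (((d.succ : ℕ) : ℤ) - 1) = 2 ^ d := by
    rw [Nat.cast_succ, add_sub_cancel_right, zpow_natCast]
  rw [hexp]
  set s : ℝ := 1 / 2 ^ d with hs
  have hs0 : 0 < s := by positivity
  have hs1 : s ≤ 1 := by
    rw [hs, div_le_one (by positivity)]; exact one_le_pow₀ one_le_two
  set D := P.natDegree with hD
  have hL : P.leadingCoeff ≠ 0 := leadingCoeff_ne_zero.2 hP0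
  -- prime factors of size at most `T` are harmless, since they bound `lpf Q`
  set T : ℝ := (D : ℝ) ^ 2 + cardPowDegree P.leadingCoeff with hT
  have hL0 : (0 : ℝ) < cardPowDegree P.leadingCoeff := by
    exact_mod_cast AbsoluteValue.pos cardPowDegree hL
  have hT0 : 0 < T := by positivity
  set C : ℝ := T + (d * D ^ 2 : ℝ) ^ s + D with hC
  have hC0 : 0 < C := by positivity
  have hmain : ∀ Q : F[X], Q.Monic → Q ≠ 1 → ∀ A : Finset (F[X] ⧸ Ideal.span {Q}),
      AvoidsDifferences P Q A →
        (A.card : ℝ) ≤ C * ((cardPowDegree Q : ℝ) * (lpf Q : ℝ) ^ (-s)) := by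
    intro Q hQ hQ1 A hA
    obtain ⟨R, hR, hirr, hRQ, hRlpf⟩ := exists_lpf_eq (mt hQ.isUnit_iff.1 hQ1)
    rw [← hRlpf]
    have hMpos : (0 : ℝ) < cardPowDegree Q := by
      exact_mod_cast AbsoluteValue.pos cardPowDegree hQ.ne_zero
    have hq1 : (1 : ℝ) ≤ cardPowDegree R := by
      exact_mod_cast (AbsoluteValue.pos cardPowDegree hR.ne_zero : (0 : ℤ) < _)
    set q : ℝ := (cardPowDegree R : ℝ) with hq
    set M : ℝ := (cardPowDegree Q : ℝ) with hM
    have hq0 : 0 < q := by linarith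
    have hqs : q⁻¹ ≤ q ^ (-s) := by
      rw [← Real.rpow_neg_one]
      exact Real.rpow_le_rpow_of_exponent_le hq1 (by linarith)
    by_cases hsmall : q ≤ T
    · have hAM : (A.card : ℝ) ≤ M := by
        have := hQ.finite_quotient
        have : Finite (F[X] ⧸ Ideal.span {Q}) := Module.finite_of_finite F
        let := Fintype.ofFinite (F[X] ⧸ Ideal.span {Q})
        rw [hM, ← natCard_quotient_span hQ, Nat.card_eq_fintype_card]
        exact_mod_cast Finset.card_le_univ A
      have h1 : 1 ≤ C * q ^ (-s) := by
        calc (1 : ℝ) = q * q⁻¹ := (mul_inv_cancel₀ hq0.ne').symm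
          _ ≤ C * q ^ (-s) := by
            have hB0 : (0 : ℝ) ≤ (d * D ^ 2 : ℝ) ^ s := by positivity
            have hD0 : (0 : ℝ) ≤ D := by positivity
            have : q ≤ C := by linarith
            gcongr
      nlinarith
    · rw [not_le] at hsmall
      have hlead : ¬ R ∣ P.leadingCoeff := by
        intro h
        have h1 : cardPowDegree R ≤ cardPowDegree P.leadingCoeff := by
          rw [cardPowDegree_nonzero _ hR.ne_zero, cardPowDegree_nonzero _ hL]
          exact pow_le_pow_right₀ (by exact_mod_cast Fintype.card_pos)
            (natDegree_le_of_dvd h hL)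
        have h2 : q ≤ cardPowDegree P.leadingCoeff := Int.cast_le.2 h1
        have h3 : (0 : ℝ) ≤ (D : ℝ) ^ 2 := by positivity
        linarith
      have hlarge : (P.natDegree : ℤ) ^ 2 < cardPowDegree R := by
        have : (D : ℝ) ^ 2 < cardPowDegree R := by linarith
        exact_mod_cast this
      refine (card_le_of_avoidsDifferences hP hk hQ hR hirr hRQ hlead hlarge A hA).trans ?_
      rw [← hq, ← hs, ← hM, Real.div_rpow (by positivity) hq0.le, mul_left_comm]
      refine mul_le_mul_of_nonneg_left ?_ hMpos.le
      rw [div_eq_mul_inv, ← Real.rpow_neg hq0.le, div_eq_mul_inv]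
      have h4 : (D : ℝ) * q⁻¹ ≤ D * q ^ (-s) := by gcongr
      have h5 : 0 ≤ T * q ^ (-s) := by positivity
      rw [hC, add_mul, add_mul]
      linarith
  refine ⟨C, hC0, fun Q hQ hQ1 => ⟨hmain Q hQ hQ1, fun hirr => ⟨?_, natCard_quotient_span hQ,
    fun A hA => ?_⟩⟩⟩
  · exact (Ideal.Quotient.maximal_ideal_iff_isField_quotient _).1
      (PrincipalIdealRing.isMaximal_of_irreducible hirr)
  · have h := hmain Q hQ hQ1 A hA
    have hMpos : (0 : ℝ) < cardPowDegree Q := by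
      exact_mod_cast AbsoluteValue.pos cardPowDegree hQ.ne_zero
    rw [lpf_eq_of_irreducible hQ hirr] at h
    rwa [sub_eq_add_neg, Real.rpow_add hMpos, Real.rpow_one]
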